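/- Let $R$ be a finite commutative ring with unity $1\neq 0$, and let $G_R=\mathrm{Cay}(R,R^\times)$ be its unitary Cayley graph: its vertex set is $R$, and $u,v$ are adjacent if and only if $u-v$ is a unit. For a finite simple graph $G$ with vertex set $V$ and set $\mathcal A$ of arcs (ordered pairs $a=(u,v)$ of adjacent vertices, with head $t(a)=v$ and inverse $a^{-1}=(v,u)$), let $N\in\mathbb C^{V\times\mathcal A}$ and $S\in\mathbb C^{\mathcal A\times\mathcal A}$ be given by $N_{ua}=\frac{1}{\sqrt{\deg u}}\,\delta_{u,t(a)}$ and $S_{ab}=\delta_{a,b^{-1}}$, and let $U=S(2N^*N-I)$ be the time evolution matrix of the Grover walk on $G$. The graph $G$ exhibits perfect state transfer (between vertex-type states) if there are distinct vertices $u,v$, a time $\tau\in\mathbb N$ and $\gamma\in\mathbb C$ with $|\gamma|=1$ such that $N^*\mathbf e_u$ and $N^*\mathbf e_v$ are distinct unit vectors and $U^\tau N^*\mathbf e_u=\gamma N^*\mathbf e_v$. Then $G_R$ is connected and exhibits perfect state transfer if and only if $R$ is isomorphic, as a ring, to one of $$\mathbb Z_2,\quad \mathbb Z_4,\quad \mathscr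 G(2),\quad \mathbb Z_6,\quad \mathbb Z_{12},\quad \mathbb Z_3\times\mathscr G(2),$$ where $\mathbb Z_n$ is the ring of integers modulo $n$ and $\mathscr G(2)\cong\mathbb F_2[x]/(x^2)$. -/

import Mathlib

open scoped Matrix

noncomputable section

namespace GroverWalk

variable {V : Type*} [Fintype V] [DecidableEq V]

/-- The boundary matrix `N` of a graph, with rows indexed by vertices and columns by symmetric
arcs (darts): `N u a = 1 / √(deg u)` if `u` is the head of `a`, and `0` otherwise. -/
def boundaryMatrix (G : SimpleGraph V) [DecidableRel G.Adj] : Matrix V G.Dart ℂ :=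
  Matrix.of fun u a => if u = a.snd then ((1 / Real.sqrt (G.degree u) : ℝ) : ℂ) else 0

/-- The shift matrix `S`: `S a b = 1` if `a` is the inverse arc of `b`, and `0` otherwise. -/
def shiftMatrix (G : SimpleGraph V) : Matrix G.Dart G.Dart ℂ :=
  Matrix.of fun a b => if a = b.symm then 1 else 0

/-- The time evolution matrix `U = S (2 N* N - I)` of the Grover walk. -/
def timeEvolution (G : SimpleGraph V) [DecidableRel G.Adj] : Matrix G.Dart G.Dart ℂ :=
  shiftMatrix G * ((2 : ℂ) • ((boundaryMatrix G)ᴴ * boundaryMatrix G) - 1)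

/-- A state is a vector on the arcs of unit Euclidean norm. -/
def IsState (G : SimpleGraph V) [DecidableRel G.Adj] (Φ : G.Dart → ℂ) : Prop :=
  star Φ ⬝ᵥ Φ = 1

/-- Perfect state transfer from the state `Φ` to the distinct state `Ψ` at time `τ`. -/
def StateTransfer (G : SimpleGraph V) [DecidableRel G.Adj] (Φ Ψ : G.Dart → ℂ) (τ : ℕ) : Prop :=
  IsState G Φ ∧ IsState G Ψ ∧ Φ ≠ Ψ ∧
    ∃ γ : ℂ, ‖γ‖ = 1 ∧ (timeEvolution G ^ τ) *ᵥ Φ = γ • Ψ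

/-- The vector `N* e_u` attached to a vertex `u`. -/
def vertexState (G : SimpleGraph V) [DecidableRel G.Adj] (u : V) : G.Dart → ℂ :=
  (boundaryMatrix G)ᴴ *ᵥ Pi.single u 1

/-- Perfect state transfer from a vertex `u` to another vertex `v` at time `τ`. -/
def VertexTransfer (G : SimpleGraph V) [DecidableRel G.Adj] (u v : V) (τ : ℕ) : Prop :=
  u ≠ v ∧ StateTransfer G (vertexState G u) (vertexState G v) τ

/-- The graph `G` exhibits perfect state transfer (between vertex-type states). -/
def ExhibitsPST (G : SimpleGraph V) [DecidableRel G.Adj] : Prop :=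
  ∃ (u v : V) (τ : ℕ), VertexTransfer G u v τ

end GroverWalk

/-- The unitary Cayley graph `Cay(R, Rˣ)` on the additive group of `R`. -/
def unitaryCayleyGraph (R : Type*) [CommRing R] : SimpleGraph R :=
  SimpleGraph.addCayley {x : R | IsUnit x}

/-- Over a nonzero ring, `u` and `v` are adjacent exactly when `u - v` is a unit. -/
theorem unitaryCayleyGraph_adj {R : Type*} [CommRing R] [Nontrivial R] (u v : R) :
    (unitaryCayleyGraph R).Adj u v ↔ IsUnit (u - v) := by
  have h1 : IsUnit (-u + v) ↔ IsUnit (u - v) := by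
    rw [← IsUnit.neg_iff, neg_add, neg_neg, sub_eq_add_neg]
  have h2 : IsUnit (-v + u) ↔ IsUnit (u - v) := by
    rw [neg_add_eq_sub]
  simp only [unitaryCayleyGraph, SimpleGraph.addCayley_adj, Set.mem_ofPred_eq, h1, h2, or_self,
    and_iff_right_iff_imp]
  rintro h rfl
  simp at h

/-- The ring `𝒢(2) ≅ 𝔽₂[x] / (x²)` of order four: additively it is free over `ℤ/2` on `b = 1` and
`a = ε`, with `a² = 0`, `b² = b` and `ab = ba = a`. -/
abbrev RingG2 : Type := DualNumber (ZMod 2)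

end

/-! The graph is regular of degree `d`, the number of units. With `P = N S N*`, which is the
adjacency matrix over `d`, the walk satisfies `N U^n N* = T_n(P)`, and `P` is convolution by the
uniform distribution `p` on the units. Transfer from `u` to `v` at time `n` therefore forces `T_n(p)
= γ[v - u]` in the group algebra `ℂ[R]`. Conversely `T_n(p) = [w]` with `w ≠ 0` gives transfer: the
compression of `U^n` is then an isometry, so nothing leaks out of the range of `N*`.

Necessity. A surjection of finite rings carries `p` to `p`, so the equation descends to quotients.
There it is tested on elements `z` with `p z = μ z`, which give `T_n(μ) z = γ[w] z`; if `|T_n(μ)| =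
1` with `μ` rational and `n ≠ 0`, then `2μ` is an integer. Translating by a nonzero element `j` of
the Jacobson radical `J` preserves units, and `z = [j] - [0]` forces `j = w`; so `J ⊆ {0, w}`. In a
residue field of order `q > 2`, `z = [c] - [0]` has `μ = -1/(q - 1)`, so `q = 3` and `w` maps to
`0`. Two residue fields of order 3 would give `μ = 1/4`, and connectedness excludes two of order 2.
Without one of order 2, `w` lies in `J`, whence `2w = 0` although 2 is a unit. So `R/J` is `𝔽₂` or
`𝔽₂ × 𝔽₃` and `J` has at most two elements, which leaves the six rings.

Sufficiency. Each of the six satisfies `T_n(p) = [w]` for an explicit `n` among 1, 2, 3, 6, and its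
units generate it additively. -/

open scoped Matrix

noncomputable section

/-! ### Grover walks and Chebyshev polynomials of the discriminant -/

namespace GroverWalk

variable {V : Type*} [Fintype V] [DecidableEq V]

theorem shiftMatrix_mul_self (G : SimpleGraph V) [DecidableRel G.Adj] :
    shiftMatrix G * shiftMatrix G = 1 := by
  ext a b
  simp [shiftMatrix, Matrix.mul_apply, Matrix.one_apply]

theorem shiftMatrix_conjTranspose {W : Type*} [DecidableEq W] (G : SimpleGraph W) :
    (shiftMatrix G)ᴴ = shiftMatrix G := by
  ext a b
  have h : b = a.symm ↔ a = b.symm := by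
    constructor <;> rintro rfl <;> simp
  simp only [shiftMatrix, Matrix.conjTranspose_apply, Matrix.of_apply, h]
  split_ifs <;> simp

theorem boundaryMatrix_mul_shiftMatrix_apply (G : SimpleGraph V) [DecidableRel G.Adj]
    (u : V) (a : G.Dart) :
    (boundaryMatrix G * shiftMatrix G) u a =
      if u = a.fst then ((1 / Real.sqrt (G.degree u) : ℝ) : ℂ) else 0 := by
  simp [boundaryMatrix, shiftMatrix, Matrix.mul_apply]

theorem boundaryMatrix_mul_conjTranspose (G : SimpleGraph V) [DecidableRel G.Adj]
    (hG : ∀ v, 0 < G.degree v) : boundaryMatrix G * (boundaryMatrix G)ᴴ = 1 := by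
  -- Inserting `S S = 1` turns the sum over arcs with a given head into one over arcs with a given
  -- tail, which the degree counts.
  have h : boundaryMatrix G * (boundaryMatrix G)ᴴ =
      (boundaryMatrix G * shiftMatrix G) * (boundaryMatrix G * shiftMatrix G)ᴴ := by
    rw [Matrix.conjTranspose_mul, shiftMatrix_conjTranspose, Matrix.mul_assoc,
      ← Matrix.mul_assoc (shiftMatrix G), shiftMatrix_mul_self, Matrix.one_mul]
  rw [h]
  have hB := boundaryMatrix_mul_shiftMatrix_apply G
  generalize boundaryMatrix G * shiftMatrix G = B at hB
  ext u v
  simp only [Matrix.mul_apply, Matrix.conjTranspose_apply, hB]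
  rcases eq_or_ne u v with rfl | huv
  · have h2 : ((1 / Real.sqrt (G.degree u) : ℝ) : ℂ) * star ((1 / Real.sqrt (G.degree u) : ℝ) : ℂ)
        = ((G.degree u : ℂ))⁻¹ := by
      rw [Complex.star_def, Complex.conj_ofReal, ← Complex.ofReal_mul, div_mul_div_comm,
        Real.mul_self_sqrt (Nat.cast_nonneg _)]
      simp
    have h3 : ∀ a : G.Dart, (if u = a.fst then ((1 / Real.sqrt (G.degree u) : ℝ) : ℂ) else 0) *
        star (if u = a.fst then ((1 / Real.sqrt (G.degree u) : ℝ) : ℂ) else 0) =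
        if a.fst = u then ((G.degree u : ℂ))⁻¹ else 0 := by
      intro a
      by_cases ha : u = a.fst
      · rw [if_pos ha, if_pos ha.symm, h2]
      · rw [if_neg ha, if_neg (Ne.symm ha), zero_mul]
    have hd : (G.degree u : ℂ) ≠ 0 := by exact_mod_cast (hG u).ne'
    rw [Finset.sum_congr rfl fun a _ => h3 a, ← Finset.sum_filter, Finset.sum_const,
      G.dart_fst_fiber_card_eq_degree, Matrix.one_apply_eq, nsmul_eq_mul, mul_inv_cancel₀ hd]
  · rw [Matrix.one_apply_ne huv]
    refine Finset.sum_eq_zero fun a _ => ?_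
    by_cases ha : u = a.fst
    · rw [if_neg (fun h' => huv (ha.trans (Eq.symm h'))), star_zero, mul_zero]
    · rw [if_neg ha, zero_mul]

/-- The discriminant `N S N*`, whose Chebyshev polynomials govern the walk on vertex states. -/
def discriminant (G : SimpleGraph V) [DecidableRel G.Adj] : Matrix V V ℂ :=
  boundaryMatrix G * shiftMatrix G * (boundaryMatrix G)ᴴ

theorem discriminant_apply (G : SimpleGraph V) [DecidableRel G.Adj] {d : ℕ}
    (hG : ∀ v, G.degree v = d) (u v : V) :
    discriminant G u v = if G.Adj u v then (d : ℂ)⁻¹ else 0 := by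
  have h2 : ((1 / Real.sqrt d : ℝ) : ℂ) * star ((1 / Real.sqrt d : ℝ) : ℂ) = (d : ℂ)⁻¹ := by
    rw [Complex.star_def, Complex.conj_ofReal, ← Complex.ofReal_mul, div_mul_div_comm,
      Real.mul_self_sqrt (Nat.cast_nonneg _)]
    simp
  have hB := boundaryMatrix_mul_shiftMatrix_apply G
  rw [discriminant, Matrix.mul_apply]
  generalize boundaryMatrix G * shiftMatrix G = B at hB
  simp only [hB, Matrix.conjTranspose_apply, boundaryMatrix,
    Matrix.of_apply, hG]
  by_cases h : G.Adj u v
  · rw [if_pos h, Finset.sum_eq_single_of_mem (⟨(u, v), h⟩ : G.Dart) (Finset.mem_univ _)]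
    · simpa using h2
    · intro a _ ha
      by_cases h1 : u = a.fst
      · by_cases h3 : v = a.snd
        · exact absurd (SimpleGraph.Dart.ext _ _ (Prod.ext h1.symm h3.symm)) ha
        · simp [h3]
      · simp [h1]
  · rw [if_neg h]
    refine Finset.sum_eq_zero fun a _ => ?_
    by_cases h1 : u = a.fst
    · by_cases h3 : v = a.snd
      · exact absurd (by rw [h1, h3]; exact a.adj) h
      · simp [h3]
    · simp [h1]

theorem timeEvolution_mul_boundary (G : SimpleGraph V) [DecidableRel G.Adj]
    (hG : ∀ v, 0 < G.degree v) :
    timeEvolution G * (boundaryMatrix G)ᴴ = shiftMatrix G * (boundaryMatrix G)ᴴ := by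
  rw [timeEvolution, Matrix.mul_assoc, Matrix.sub_mul, Matrix.smul_mul, Matrix.mul_assoc,
    boundaryMatrix_mul_conjTranspose G hG, Matrix.mul_one, Matrix.one_mul, two_smul,
    add_sub_cancel_right]

/-- Since `U N* = S N*` and `S² = 1`, expanding the outer `U` gives the three-term Chebyshev
recurrence. -/
theorem timeEvolution_sq_mul_boundary (G : SimpleGraph V) [DecidableRel G.Adj]
    (hG : ∀ v, 0 < G.degree v) :
    timeEvolution G * (timeEvolution G * (boundaryMatrix G)ᴴ) =
      (2 : ℂ) • (timeEvolution G * (boundaryMatrix G)ᴴ * discriminant G) - (boundaryMatrix G)ᴴ := by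
  rw [timeEvolution_mul_boundary G hG]
  conv_lhs => rw [timeEvolution]
  simp only [Matrix.mul_sub, Matrix.sub_mul, Matrix.mul_smul, Matrix.smul_mul, Matrix.mul_one]
  rw [← Matrix.mul_assoc (shiftMatrix G) (shiftMatrix G), shiftMatrix_mul_self, Matrix.one_mul]
  simp only [discriminant, Matrix.mul_assoc]

theorem timeEvolution_pow_add_two_mul_boundary (G : SimpleGraph V) [DecidableRel G.Adj]
    (hG : ∀ v, 0 < G.degree v) (n : ℕ) :
    timeEvolution G ^ (n + 2) * (boundaryMatrix G)ᴴ =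
      (2 : ℂ) • (timeEvolution G ^ (n + 1) * (boundaryMatrix G)ᴴ * discriminant G) -
        timeEvolution G ^ n * (boundaryMatrix G)ᴴ := by
  rw [pow_add, pow_two, pow_succ, Matrix.mul_assoc, Matrix.mul_assoc,
    timeEvolution_sq_mul_boundary G hG, Matrix.mul_sub, Matrix.mul_smul]
  simp only [Matrix.mul_assoc]

/-- Compressing powers of the time evolution to the vertices yields Chebyshev polynomials of the
discriminant. -/
theorem boundary_mul_timeEvolution_pow (G : SimpleGraph V) [DecidableRel G.Adj]
    (hG : ∀ v, 0 < G.degree v) (n : ℕ) :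
    boundaryMatrix G * (timeEvolution G ^ n * (boundaryMatrix G)ᴴ) =
      Polynomial.aeval (discriminant G) (Polynomial.Chebyshev.T ℂ n) := by
  induction n using Nat.twoStepInduction with
  | zero => simp [boundaryMatrix_mul_conjTranspose G hG]
  | one =>
    rw [pow_one, timeEvolution_mul_boundary G hG]
    simp [discriminant, Matrix.mul_assoc]
  | more n h0 h1 =>
    rw [timeEvolution_pow_add_two_mul_boundary G hG, Matrix.mul_sub, Matrix.mul_smul,
      ← Matrix.mul_assoc, h0, h1]
    push_cast
    rw [Polynomial.Chebyshev.T_add_two, mul_assoc, mul_comm Polynomial.X]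
    simp [two_smul, two_mul]

/-- `N* N` is an orthogonal projection, so `2 N* N - 1` is a reflection; `S` is a self-adjoint
involution. -/
theorem timeEvolution_conjTranspose_mul_self (G : SimpleGraph V) [DecidableRel G.Adj]
    (hG : ∀ v, 0 < G.degree v) : (timeEvolution G)ᴴ * timeEvolution G = 1 := by
  have h : (boundaryMatrix G)ᴴ * boundaryMatrix G * ((boundaryMatrix G)ᴴ * boundaryMatrix G) =
      (boundaryMatrix G)ᴴ * boundaryMatrix G := by
    rw [Matrix.mul_assoc, ← Matrix.mul_assoc (boundaryMatrix G),
      boundaryMatrix_mul_conjTranspose G hG, Matrix.one_mul]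
  rw [timeEvolution, Matrix.conjTranspose_mul, shiftMatrix_conjTranspose, Matrix.mul_assoc,
    ← Matrix.mul_assoc (shiftMatrix G), shiftMatrix_mul_self, Matrix.one_mul]
  simp only [Matrix.conjTranspose_sub, Matrix.conjTranspose_smul, Matrix.conjTranspose_mul,
    Matrix.conjTranspose_conjTranspose, Matrix.conjTranspose_one, Matrix.sub_mul, Matrix.mul_sub,
    Matrix.smul_mul, Matrix.mul_smul, h, Matrix.one_mul, Matrix.mul_one]
  simp only [Complex.star_def, map_ofNat]
  module

theorem timeEvolution_pow_conjTranspose_mul_self (G : SimpleGraph V) [DecidableRel G.Adj]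
    (hG : ∀ v, 0 < G.degree v) (n : ℕ) :
    (timeEvolution G ^ n)ᴴ * timeEvolution G ^ n = 1 := by
  induction n with
  | zero => simp
  | succ n ih =>
    rw [pow_succ', Matrix.conjTranspose_mul, Matrix.mul_assoc, ← Matrix.mul_assoc _ᴴ (timeEvolution G),
      timeEvolution_conjTranspose_mul_self G hG, Matrix.one_mul, ih]

-- An isometry whose compression to the range of `N*` already preserves norms cannot leave that
-- range. This recovers the walk itself from its Chebyshev compression.
open scoped ComplexOrder in
theorem timeEvolution_pow_mul_boundary_of_isometry (G : SimpleGraph V) [DecidableRel G.Adj]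
    (hG : ∀ v, 0 < G.degree v) (n : ℕ) {Q : Matrix V V ℂ} (hQ : Qᴴ * Q = 1)
    (h : Polynomial.aeval (discriminant G) (Polynomial.Chebyshev.T ℂ n) = Q) :
    timeEvolution G ^ n * (boundaryMatrix G)ᴴ = (boundaryMatrix G)ᴴ * Q := by
  rw [← boundary_mul_timeEvolution_pow G hG] at h
  set K := (boundaryMatrix G)ᴴ with hK
  have hN : boundaryMatrix G = Kᴴ := by simp [hK]
  have hKK : Kᴴ * K = 1 := by rw [← hN]; exact boundaryMatrix_mul_conjTranspose G hG
  set X := timeEvolution G ^ n * K with hX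
  have hXX : Xᴴ * X = 1 := by
    rw [hX, Matrix.conjTranspose_mul, Matrix.mul_assoc, ← Matrix.mul_assoc _ᴴ (timeEvolution G ^ n),
      timeEvolution_pow_conjTranspose_mul_self G hG, Matrix.one_mul, hKK]
  rw [hN] at h
  have h' : Xᴴ * K = Qᴴ := by rw [← h]; simp
  -- The Gram matrix of `X - K Q` is `1 - Q*Q - Q*Q + Q*Q`, which vanishes.
  rw [← sub_eq_zero, ← Matrix.conjTranspose_mul_self_eq_zero]
  simp only [Matrix.conjTranspose_sub, Matrix.conjTranspose_mul, Matrix.sub_mul, Matrix.mul_sub]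
  rw [hXX, ← Matrix.mul_assoc Xᴴ, h', hQ, Matrix.mul_assoc, h, hQ, Matrix.mul_assoc,
    ← Matrix.mul_assoc Kᴴ, hKK, Matrix.one_mul, hQ]
  simp

theorem isState_vertexState (G : SimpleGraph V) [DecidableRel G.Adj]
    (hG : ∀ v, 0 < G.degree v) (u : V) : IsState G (vertexState G u) := by
  rw [IsState, vertexState, Matrix.star_mulVec, Matrix.conjTranspose_conjTranspose,
    Matrix.dotProduct_mulVec, Matrix.vecMul_vecMul, boundaryMatrix_mul_conjTranspose G hG,
    Matrix.vecMul_one]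
  simp

theorem boundary_mulVec_vertexState (G : SimpleGraph V) [DecidableRel G.Adj]
    (hG : ∀ v, 0 < G.degree v) (u : V) :
    boundaryMatrix G *ᵥ vertexState G u = Pi.single u 1 := by
  rw [vertexState, Matrix.mulVec_mulVec, boundaryMatrix_mul_conjTranspose G hG, Matrix.one_mulVec]

theorem vertexState_injective (G : SimpleGraph V) [DecidableRel G.Adj]
    (hG : ∀ v, 0 < G.degree v) : Function.Injective (vertexState G) := by
  intro u v h
  have := congrArg (boundaryMatrix G *ᵥ ·) h
  simp only [boundary_mulVec_vertexState G hG] at this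
  by_contra huv
  simpa [huv] using congrFun this u

theorem VertexTransfer.chebyshev {G : SimpleGraph V} [DecidableRel G.Adj]
    (hG : ∀ v, 0 < G.degree v) {u v : V} {n : ℕ} (h : VertexTransfer G u v n) :
    ∃ γ : ℂ, ‖γ‖ = 1 ∧ Polynomial.aeval (discriminant G) (Polynomial.Chebyshev.T ℂ n) *ᵥ
      Pi.single u 1 = γ • Pi.single v 1 := by
  obtain ⟨-, -, -, -, γ, hγ, h⟩ := h
  refine ⟨γ, hγ, ?_⟩
  rw [← boundary_mul_timeEvolution_pow G hG, ← Matrix.mulVec_mulVec, ← Matrix.mulVec_mulVec,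
    ← vertexState, h, Matrix.mulVec_smul, boundary_mulVec_vertexState G hG]

theorem vertexTransfer_of_chebyshev {G : SimpleGraph V} [DecidableRel G.Adj]
    (hG : ∀ v, 0 < G.degree v) {u v : V} (huv : u ≠ v) {n : ℕ} {Q : Matrix V V ℂ}
    (hQ : Qᴴ * Q = 1) (h : Polynomial.aeval (discriminant G) (Polynomial.Chebyshev.T ℂ n) = Q)
    (hv : Q *ᵥ Pi.single u 1 = Pi.single v 1) : VertexTransfer G u v n := by
  refine ⟨huv, isState_vertexState G hG u, isState_vertexState G hG v,
    (vertexState_injective G hG).ne huv, 1, norm_one, ?_⟩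
  rw [one_smul, vertexState, Matrix.mulVec_mulVec,
    timeEvolution_pow_mul_boundary_of_isometry G hG n hQ h, ← Matrix.mulVec_mulVec, hv, vertexState]

end GroverWalk

/-! ### Transfer as an equation in the group algebra -/

open AddMonoidAlgebra

/-- The uniform distribution on the units of `R`, as an element of the group algebra of the
additive group of `R`. -/
def unitAverage (R : Type*) [CommRing R] [Fintype Rˣ] : AddMonoidAlgebra ℂ R :=
  (Fintype.card Rˣ : ℂ)⁻¹ • ∑ s : Rˣ, single (s : R) 1

open Classical in
theorem coeff_unitAverage {R : Type*} [CommRing R] [Fintype Rˣ] (x : R) :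
    (unitAverage R).coeff x = if IsUnit x then (Fintype.card Rˣ : ℂ)⁻¹ else 0 := by
  simp only [unitAverage, coeff_smul, coeff_sum, coeff_single, Finsupp.smul_apply,
    Finsupp.finsetSum_apply, smul_eq_mul]
  split_ifs with h
  · obtain ⟨s, rfl⟩ := h
    rw [Finset.sum_eq_single_of_mem s (Finset.mem_univ _), Finsupp.single_eq_same, mul_one]
    intro t _ hts
    exact Finsupp.single_eq_of_ne (fun h => hts (Units.ext h.symm))
  · rw [Finset.sum_eq_zero, mul_zero]
    rintro t -
    exact Finsupp.single_eq_of_ne (fun h' => h ⟨t, h'.symm⟩)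

/-- The representation of the group algebra of a finite abelian group by convolution matrices. -/
def convolutionMatrix (A : Type*) [AddCommGroup A] [Fintype A] [DecidableEq A] :
    AddMonoidAlgebra ℂ A →ₐ[ℂ] Matrix A A ℂ :=
  AddMonoidAlgebra.lift ℂ (Matrix A A ℂ) A
    { toFun := fun a => Matrix.of fun x y => if x - y = a.toAdd then 1 else 0
      map_one' := by
        ext x y
        simp [Matrix.one_apply, sub_eq_zero]
      map_mul' := fun a b => by
        ext x y
        rw [Matrix.mul_apply, Finset.sum_eq_single_of_mem (x - a.toAdd) (Finset.mem_univ _)]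
        · have h : x - a.toAdd - y = b.toAdd ↔ x - y = a.toAdd + b.toAdd := by
            rw [sub_right_comm, sub_eq_iff_eq_add']
          simp only [Matrix.of_apply, toAdd_mul, sub_sub_cancel, if_true, one_mul, h]
        · intro z _ hz
          rw [Matrix.of_apply, if_neg, zero_mul]
          rintro h
          exact hz (by rw [← h, sub_sub_cancel]) }

theorem convolutionMatrix_apply {A : Type*} [AddCommGroup A] [Fintype A] [DecidableEq A]
    (z : AddMonoidAlgebra ℂ A) (x y : A) : convolutionMatrix A z x y = z.coeff (x - y) := by
  induction z using AddMonoidAlgebra.induction_linear with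
  | zero => simp
  | add z w hz hw => simp [hz, hw]
  | single a r =>
    rw [convolutionMatrix, AddMonoidAlgebra.lift_single]
    simp [Finsupp.single_apply, eq_comm (a := a)]

section Graph

variable {R : Type*} [CommRing R] [Nontrivial R] [Fintype R] [DecidableEq R]
  [DecidableRel (unitaryCayleyGraph R).Adj]

theorem unitaryCayleyGraph_degree (v : R) :
    (unitaryCayleyGraph R).degree v = Fintype.card Rˣ := by
  rw [← SimpleGraph.card_neighborSet_eq_degree]
  refine Fintype.card_congr
    { toFun := fun w => ((unitaryCayleyGraph_adj _ _).1 w.2).unit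
      invFun := fun s => ⟨v - s, (unitaryCayleyGraph_adj _ _).2 (by simp)⟩
      left_inv := fun w => by ext; simp
      right_inv := fun s => by ext; simp }

theorem unitaryCayleyGraph_degree_pos (v : R) : 0 < (unitaryCayleyGraph R).degree v := by
  rw [unitaryCayleyGraph_degree]
  exact Fintype.card_pos

theorem discriminant_unitaryCayleyGraph :
    GroverWalk.discriminant (unitaryCayleyGraph R) = convolutionMatrix R (unitAverage R) := by
  ext x y
  rw [GroverWalk.discriminant_apply _ unitaryCayleyGraph_degree, convolutionMatrix_apply,
    coeff_unitAverage]
  simp only [unitaryCayleyGraph_adj]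
  split_ifs <;> rfl

theorem aeval_unitAverage_of_exhibitsPST (h : GroverWalk.ExhibitsPST (unitaryCayleyGraph R)) :
    ∃ (n : ℕ) (w : R) (γ : ℂ), w ≠ 0 ∧ ‖γ‖ = 1 ∧
      Polynomial.aeval (unitAverage R) (Polynomial.Chebyshev.T ℂ n) = single w γ := by
  obtain ⟨u, v, n, huv, h⟩ := h
  obtain ⟨γ, hγ, h⟩ := GroverWalk.VertexTransfer.chebyshev unitaryCayleyGraph_degree_pos ⟨huv, h⟩
  rw [discriminant_unitaryCayleyGraph, Polynomial.aeval_algHom_apply] at h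
  refine ⟨n, v - u, γ, sub_ne_zero.2 huv.symm, hγ, ?_⟩
  ext x
  -- Column `u` of a convolution matrix lists the coefficients shifted by `u`; evaluating at `x + u`
  -- undoes the shift.
  have hx := congrFun h (x + u)
  simp only [Matrix.mulVec_single_one, Matrix.col_apply, convolutionMatrix_apply,
    add_sub_cancel_right, Pi.smul_apply, smul_eq_mul, Pi.single_apply] at hx
  rw [hx, coeff_single, Finsupp.single_apply]
  simp [eq_comm (a := v - u), eq_sub_iff_add_eq]

theorem exhibitsPST_of_aeval_unitAverage {n : ℕ} {w : R} (hw : w ≠ 0)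
    (h : Polynomial.aeval (unitAverage R) (Polynomial.Chebyshev.T ℂ n) = single w 1) :
    GroverWalk.ExhibitsPST (unitaryCayleyGraph R) := by
  refine ⟨0, w, n, GroverWalk.vertexTransfer_of_chebyshev unitaryCayleyGraph_degree_pos hw.symm
    (Q := convolutionMatrix R (single w 1)) ?_ ?_ ?_⟩
  · have hs : (convolutionMatrix R (single w 1))ᴴ = convolutionMatrix R (single (-w) 1) := by
      ext x y
      rw [Matrix.conjTranspose_apply, convolutionMatrix_apply, convolutionMatrix_apply,
        coeff_single, coeff_single, Finsupp.single_apply, Finsupp.single_apply]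
      simp only [show w = y - x ↔ -w = x - y by rw [neg_eq_iff_eq_neg, neg_sub]]
      split_ifs <;> simp
    rw [hs, ← map_mul, single_mul_single, neg_add_cancel, one_mul, ← one_def, map_one]
  · rw [discriminant_unitaryCayleyGraph, Polynomial.aeval_algHom_apply, h]
  · ext x
    simp [convolutionMatrix_apply, Pi.single_apply, Finsupp.single_apply, eq_comm]

end Graph

/-! ### Descent to quotients, and eigenvectors -/

/-- A surjective homomorphism from a finite ring is surjective on units. -/
theorem exists_unit_map_eq {R S : Type*} [CommRing R] [CommRing S] [Finite R] (φ : R →+* S)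
    (hφ : Function.Surjective φ) (t : Sˣ) : ∃ s : Rˣ, φ s = t := by
  obtain ⟨a, ha⟩ := hφ t
  obtain ⟨k, l, hkl, hpow⟩ : ∃ k l : ℕ, k < l ∧ a ^ k = a ^ l := by
    obtain ⟨k, l, hne, h⟩ := Finite.exists_ne_map_eq_of_infinite (fun n : ℕ => a ^ n)
    rcases hne.lt_or_gt with h' | h'
    exacts [⟨k, l, h', h⟩, ⟨l, k, h', h.symm⟩]
  obtain ⟨d, hd, rfl⟩ : ∃ d, 0 < d ∧ l = k + d := ⟨l - k, by omega, by omega⟩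
  have hstep : ∀ i m, a ^ (k + m) = a ^ (k + m + i * d) := by
    intro i
    induction i with
    | zero => simp
    | succ i ih =>
      intro m
      rw [ih m, show k + m + i * d = k + (m + i * d) by ring, pow_add, hpow, ← pow_add]
      congr 1
      ring
  -- The exponent `(k + 1) * d` is a positive multiple of the period `d` and at least the preperiod
  -- `k`, so this power of `a` is idempotent.
  have hn : (k + 1) * d = k + ((k + 1) * d - k) :=
    (Nat.add_sub_of_le (by nlinarith)).symm
  have hpos : 0 < (k + 1) * d := by positivity
  generalize (k + 1) * d - k = m at hn
  have hidem : a ^ ((k + 1) * d) * a ^ ((k + 1) * d) = a ^ ((k + 1) * d) := by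
    rw [← pow_add]
    conv_rhs => rw [hn, hstep (k + 1) m, ← hn]
  obtain ⟨e, he⟩ : ∃ e, e = a ^ ((k + 1) * d) := ⟨_, rfl⟩
  obtain ⟨j, hj⟩ : ∃ j, (k + 1) * d = j + 1 := ⟨_, (Nat.sub_add_cancel hpos).symm⟩
  rw [← he] at hidem
  have hφe : φ e = 1 := by
    have h1 : IsUnit (φ e) := by rw [he, map_pow, ha, ← Units.val_pow_eq_pow_val]; exact t.isUnit.pow _
    have h2 : φ e * φ e = φ e * 1 := by rw [← map_mul, hidem, mul_one]
    exact h1.mul_left_cancel h2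
  -- `a` is invertible on the `e` part, so replacing it by 1 on the complementary part gives a unit;
  -- its image is unchanged because `φ e = 1`.
  have hu : (a * e + (1 - e)) * (a ^ j * e + (1 - e)) = 1 := by
    have : a * a ^ j = e := by rw [he, hj, pow_succ']
    linear_combination (e ^ 2) * this + (e + 2 - a - a ^ j) * hidem
  refine ⟨Units.mkOfMulEqOne _ _ hu, ?_⟩
  rw [Units.val_mkOfMulEqOne, map_add, map_mul, map_sub, hφe, ha]
  simp

/-- The homomorphism of group algebras induced by a ring homomorphism. -/
def groupAlgebraMap {R S : Type*} [CommRing R] [CommRing S] (φ : R →+* S) :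
    AddMonoidAlgebra ℂ R →ₐ[ℂ] AddMonoidAlgebra ℂ S :=
  AddMonoidAlgebra.mapDomainAlgHom ℂ ℂ (φ : R →+ S)

theorem groupAlgebraMap_single {R S : Type*} [CommRing R] [CommRing S] (φ : R →+* S) (a : R)
    (r : ℂ) : groupAlgebraMap φ (single a r) = single (φ a) r := by
  simp [groupAlgebraMap]

/-- The unit groups surject, and the fibres are cosets of the kernel, all of one size; so the
uniform distribution pushes forward to the uniform one. -/
theorem groupAlgebraMap_unitAverage {R S : Type*} [CommRing R] [CommRing S] [Finite R]
    [Fintype Rˣ] [Fintype Sˣ] (φ : R →+* S) (hφ : Function.Surjective φ) :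
    groupAlgebraMap φ (unitAverage R) = unitAverage S := by
  classical
  have hsurj : Function.Surjective (Units.map (φ : R →* S)) := fun t => by
    obtain ⟨s, hs⟩ := exists_unit_map_eq φ hφ t
    exact ⟨s, Units.ext hs⟩
  set c := (Finset.univ.filter fun s : Rˣ => Units.map (φ : R →* S) s = 1).card with hc
  have hfib : ∀ t : Sˣ, (Finset.univ.filter fun s : Rˣ => Units.map (φ : R →* S) s = t).card = c :=
    fun t => MonoidHom.card_fiber_eq_of_mem_range _ (hsurj t) (hsurj 1)
  have hcard : Fintype.card Rˣ = Fintype.card Sˣ * c := by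
    rw [← Finset.card_univ, Finset.card_eq_sum_card_fiberwise
      (fun s _ => Finset.mem_coe.2 (Finset.mem_univ (Units.map (φ : R →* S) s))),
      Finset.sum_congr rfl fun t _ => hfib t, Finset.sum_const, Finset.card_univ, smul_eq_mul]
  have hR : (Fintype.card Rˣ : ℂ) ≠ 0 := by exact_mod_cast Fintype.card_ne_zero
  have hsum : ∑ s : Rˣ, single (φ s) (1 : ℂ) = (c : ℂ) • ∑ t : Sˣ, single (t : S) (1 : ℂ) := by
    have := Finset.sum_comp (s := Finset.univ) (fun t : Sˣ => single (t : S) (1 : ℂ))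
      (Units.map (φ : R →* S))
    simp only [Units.coe_map, MonoidHom.coe_coe] at this
    rw [this, Finset.image_univ_of_surjective hsurj, Finset.smul_sum]
    refine Finset.sum_congr rfl fun t _ => ?_
    rw [hfib, Nat.cast_smul_eq_nsmul]
  rw [unitAverage, map_smul, map_sum]
  simp only [groupAlgebraMap_single]
  rw [hsum, smul_smul, unitAverage]
  congr 1
  rw [hcard] at hR ⊢
  push_cast at hR ⊢
  field_simp [left_ne_zero_of_mul hR, right_ne_zero_of_mul hR]

/-- Explicit eigenvectors `z` take the place of the characters of the additive group. -/
theorem Polynomial.aeval_mul_of_mul_eq_smul {A : Type*} [CommRing A] [Algebra ℂ A] {p z : A} {μ : ℂ}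
    (h : p * z = μ • z) (P : Polynomial ℂ) : Polynomial.aeval p P * z = P.eval μ • z := by
  induction P using Polynomial.induction_on' with
  | add P Q hP hQ => rw [map_add, add_mul, hP, hQ, Polynomial.eval_add, add_smul]
  | monomial n a =>
    rw [Polynomial.aeval_monomial, Polynomial.eval_monomial, mul_assoc, mul_smul,
      ← Algebra.smul_def]
    congr 1
    induction n with
    | zero => simp
    | succ n ih => rw [pow_succ, mul_assoc, h, mul_smul_comm, ih, smul_smul, ← pow_succ']

/-! ### Integrality of Chebyshev arguments -/

namespace Polynomial.Chebyshev

/-- The rescaling `C_n(2x) = 2 T_n(x)` has integer coefficients. The index starts at 1 because `C_0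
= 2` is not monic. -/
theorem monic_C_and_natDegree (n : ℕ) :
    (C ℤ (n + 1 : ℕ)).Monic ∧ (C ℤ (n + 1 : ℕ)).natDegree = n + 1 := by
  induction n using Nat.twoStepInduction with
  | zero => simp [monic_X]
  | one =>
    have h : C ℤ ((1 + 1 : ℕ) : ℤ) = X ^ 2 - Polynomial.C 2 := by
      rw [show ((1 + 1 : ℕ) : ℤ) = 2 from rfl, C_two]
      rfl
    rw [h]
    exact ⟨monic_X_pow_sub_C _ two_ne_zero, natDegree_X_pow_sub_C⟩
  | more n h0 h1 =>
    have h : C ℤ ((n + 2 + 1 : ℕ) : ℤ) = X * C ℤ ((n + 1 + 1 : ℕ) : ℤ) - C ℤ ((n + 1 : ℕ) : ℤ) := by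
      rw [show ((n + 2 + 1 : ℕ) : ℤ) = ((n + 1 : ℕ) : ℤ) + 2 by push_cast; ring, C_add_two]
      push_cast
      rfl
    have hm : (X * C ℤ ((n + 1 + 1 : ℕ) : ℤ)).Monic := monic_X.mul h1.1
    have hd : (X * C ℤ ((n + 1 + 1 : ℕ) : ℤ)).natDegree = n + 2 + 1 := by
      rw [monic_X.natDegree_mul h1.1, h1.2, natDegree_X]
      ring
    have hlt : (C ℤ ((n + 1 : ℕ) : ℤ)).natDegree < (X * C ℤ ((n + 1 + 1 : ℕ) : ℤ)).natDegree := by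
      rw [h0.2, hd]
      omega
    rw [h]
    exact ⟨hm.sub_of_left (degree_lt_degree hlt), by rw [natDegree_sub_eq_left_of_natDegree_lt hlt, hd]⟩

/-- A rational number at which a Chebyshev polynomial of positive index has absolute value one is
a half-integer. -/
theorem exists_int_of_norm_eval_T_eq_one {n : ℕ} (hn : n ≠ 0) {μ : ℚ}
    (h : ‖(T ℂ n).eval (μ : ℂ)‖ = 1) : ∃ k : ℤ, (k : ℚ) = 2 * μ := by
  have h1 : (T ℂ n).eval (μ : ℂ) = (((T ℚ n).eval μ : ℚ) : ℂ) := by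
    simpa using (algebraMap_eval_T (R := ℚ) (R' := ℂ) μ n).symm
  have h2 : (T ℚ n).eval μ ^ 2 = 1 := by
    rw [h1] at h
    have h3 : |(T ℚ n).eval μ| = 1 := by
      have : ‖(((T ℚ n).eval μ : ℚ) : ℂ)‖ = ((|(T ℚ n).eval μ| : ℚ) : ℝ) := by
        rw [← Complex.ofReal_ratCast, Complex.norm_real, Real.norm_eq_abs, Rat.cast_abs]
      rw [this] at h
      exact_mod_cast h
    rw [← sq_abs, h3, one_pow]
  have h4 : (C ℚ n).eval (2 * μ) = 2 * (T ℚ n).eval μ := by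
    have := congrArg (Polynomial.eval μ) (C_comp_two_mul_X ℚ n)
    simpa using this
  obtain ⟨m, rfl⟩ := Nat.exists_eq_succ_of_ne_zero hn
  obtain ⟨hm, hd⟩ := monic_C_and_natDegree m
  -- `T_n(μ)² = 1` makes `2μ` a rational root of this monic integer polynomial, hence an integer.
  have hm2 : (C ℤ (m + 1 : ℕ) ^ 2 - Polynomial.C 4).Monic := by
    refine (hm.pow 2).sub_of_left (degree_lt_degree ?_)
    rw [natDegree_C, hm.natDegree_pow, hd]
    omega
  have hroot : aeval (2 * μ) (C ℤ (m + 1 : ℕ) ^ 2 - Polynomial.C 4) = 0 := by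
    rw [map_sub, map_pow, aeval_C]
    rw [h4, mul_pow, h2]
    rw [Polynomial.aeval_C]
    norm_num
  obtain ⟨k, hk⟩ := isInteger_of_is_root_of_monic hm2 hroot
  exact ⟨k, by simpa using hk⟩

end Polynomial.Chebyshev

/-! ### Eigenvectors tested against the transfer equation -/

section Transfer

variable {R : Type*} [CommRing R] {n : ℕ} {w : R} {γ : ℂ}

theorem aeval_unitAverage_map [Fintype Rˣ] {S : Type*} [CommRing S] [Fintype Sˣ] [Finite R]
    (h : Polynomial.aeval (unitAverage R) (Polynomial.Chebyshev.T ℂ n) = single w γ)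
    (φ : R →+* S) (hφ : Function.Surjective φ) :
    Polynomial.aeval (unitAverage S) (Polynomial.Chebyshev.T ℂ n) = single (φ w) γ := by
  rw [← groupAlgebraMap_unitAverage φ hφ, Polynomial.aeval_algHom_apply, h, groupAlgebraMap_single]

/-- Translation by `j` fixes the uniform distribution, so `[j] - [0]` has eigenvalue 0. At `w`, the
coefficient of `γ[w]([j] - [0])` is `-γ ≠ 0`, while a multiple of `[j] - [0]` has a nonzero
coefficient there only if `j = w`. -/
theorem eq_of_add_isUnit_iff [Fintype Rˣ] (hw : w ≠ 0) (hγ : ‖γ‖ = 1)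
    (h : Polynomial.aeval (unitAverage R) (Polynomial.Chebyshev.T ℂ n) = single w γ)
    {j : R} (hj0 : j ≠ 0) (hj : ∀ x, IsUnit (x - j) ↔ IsUnit x) : j = w := by
  have hp : unitAverage R * (single j 1 - 1) = (0 : ℂ) • (single j 1 - 1) := by
    rw [zero_smul, mul_sub, mul_one, sub_eq_zero]
    ext x
    rw [coeff_mul_single_apply, mul_one, coeff_unitAverage, coeff_unitAverage, ← sub_eq_add_neg]
    by_cases hx : IsUnit x
    · rw [if_pos hx, if_pos ((hj x).2 hx)]
    · rw [if_neg hx, if_neg (mt (hj x).1 hx)]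
  have key := Polynomial.aeval_mul_of_mul_eq_smul hp (Polynomial.Chebyshev.T ℂ n)
  rw [h, mul_sub, mul_one, single_mul_single, mul_one] at key
  have hc := congrArg (fun z => z.coeff w) key
  have hγ0 : γ ≠ 0 := by
    rintro rfl
    simp at hγ
  by_contra hne
  simp [coeff_sub, one_def, hj0, hne, hw.symm] at hc
  exact hγ0 hc

theorem eval_eq_of_isUnit_of_ne_zero [Fintype Rˣ] [Nontrivial R] (hR : ∀ x : R, x ≠ 0 → IsUnit x)
    (hcard : 2 < Nat.card R) (hγ : ‖γ‖ = 1)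
    (h : Polynomial.aeval (unitAverage R) (Polynomial.Chebyshev.T ℂ n) = single w γ) :
    w = 0 ∧ (Polynomial.Chebyshev.T ℂ n).eval (-(Fintype.card Rˣ : ℂ)⁻¹) = γ := by
  classical
  have hu : ∀ x : R, IsUnit x ↔ x ≠ 0 := fun x => ⟨fun h => h.ne_zero, hR x⟩
  have hγ0 : γ ≠ 0 := by
    rintro rfl
    simp at hγ
  have key : ∀ c : R, c ≠ 0 → (Polynomial.Chebyshev.T ℂ n).eval (-(Fintype.card Rˣ : ℂ)⁻¹) *
      ((if c = w then 1 else 0) - (if w = 0 then 1 else 0)) = -γ := by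
    intro c hc
    have hp : unitAverage R * (single c 1 - 1) = (-(Fintype.card Rˣ : ℂ)⁻¹) • (single c 1 - 1) := by
      rw [mul_sub, mul_one]
      ext x
      rw [coeff_sub, Finsupp.sub_apply, coeff_mul_single_apply, mul_one, coeff_unitAverage,
        coeff_unitAverage, ← sub_eq_add_neg, coeff_smul, Finsupp.smul_apply, coeff_sub,
        Finsupp.sub_apply, one_def, coeff_single, coeff_single, Finsupp.single_apply,
        Finsupp.single_apply]
      simp only [hu, ne_eq, sub_eq_zero, eq_comm (a := c), eq_comm (a := (0 : R))]
      by_cases hx : x = c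
      · simp [hx, hc]
      · by_cases hx0 : x = 0 <;> simp [hx, hx0, hc.symm]
    have key := Polynomial.aeval_mul_of_mul_eq_smul hp (Polynomial.Chebyshev.T ℂ n)
    rw [h, mul_sub, mul_one, single_mul_single, mul_one] at key
    have hc' := congrArg (fun z => z.coeff w) key
    simp only [coeff_sub, coeff_smul, coeff_single, one_def, Finsupp.sub_apply,
      Finsupp.smul_apply, Finsupp.single_apply, smul_eq_mul, add_eq_left, hc, if_true, if_false,
      eq_comm (a := (0 : R))] at hc'
    rw [← hc', zero_sub]
  have : Finite R := Nat.finite_of_card_ne_zero (by omega)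
  have := Fintype.ofFinite R
  have hw : w = 0 := by
    by_contra hw
    -- This is where order greater than 2 enters: for such a `c`, the left side of `key` is zero.
    obtain ⟨c, hc⟩ : ∃ c, c ∉ ({0, w} : Finset R) := by
      by_contra! hall
      have h1 := Finset.card_le_card (fun x _ => hall x : (Finset.univ : Finset R) ⊆ {0, w})
      have h2 := Finset.card_le_two (a := (0 : R)) (b := w)
      rw [Finset.card_univ, ← Nat.card_eq_fintype_card] at h1
      omega
    simp only [Finset.mem_insert, Finset.mem_singleton, not_or] at hc
    have := key c hc.1
    simp [hc.2, hw] at this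
    exact hγ0 this
  refine ⟨hw, ?_⟩
  have := key 1 one_ne_zero
  simpa [hw] using this

theorem eval_eq_of_prod {S : Type*} [CommRing S] [Nontrivial R] [Nontrivial S] [Fintype Sˣ]
    (hR : ∀ x : R, x ≠ 0 → IsUnit x) (hS : ∀ x : S, x ≠ 0 → IsUnit x) [Fintype (R × S)ˣ]
    (h : Polynomial.aeval (unitAverage (R × S)) (Polynomial.Chebyshev.T ℂ n) = single 0 γ) :
    (Polynomial.Chebyshev.T ℂ n).eval (Fintype.card (R × S)ˣ : ℂ)⁻¹ = γ := by
  classical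
  have hu : ∀ x : R × S, IsUnit x ↔ x.1 ≠ 0 ∧ x.2 ≠ 0 := fun x => by
    rw [Prod.isUnit_iff]
    exact and_congr ⟨fun h => h.ne_zero, hR _⟩ ⟨fun h => h.ne_zero, hS _⟩
  set d := (Fintype.card (R × S)ˣ : ℂ)⁻¹ with hd
  -- The tensor product of `[1] - [0]` with itself; its eigenvalue is the product of the two field
  -- eigenvalues, so the signs cancel.
  let z : AddMonoidAlgebra ℂ (R × S) :=
    single (1, 1) 1 - single (1, 0) 1 - single (0, 1) 1 + single (0, 0) 1
  have hp : unitAverage (R × S) * z = d • z := by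
    simp only [z, mul_sub, mul_add, smul_sub, smul_add]
    ext x
    obtain ⟨x, y⟩ := x
    simp only [coeff_sub, coeff_add, coeff_smul, Finsupp.sub_apply, Finsupp.add_apply,
      Finsupp.smul_apply, coeff_mul_single_apply, coeff_unitAverage, coeff_single,
      Finsupp.single_apply, hu, Prod.mk.injEq, ← sub_eq_add_neg, Prod.mk_sub_mk, sub_zero,
      ne_eq, sub_eq_zero, ← hd, eq_comm (b := x), eq_comm (b := y), smul_eq_mul]
    by_cases h1 : x = 0 <;> by_cases h2 : x = 1 <;> by_cases h3 : y = 0 <;> by_cases h4 : y = 1 <;>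
      simp_all
  have key := Polynomial.aeval_mul_of_mul_eq_smul hp (Polynomial.Chebyshev.T ℂ n)
  rw [h] at key
  have hc := congrArg (fun z => z.coeff 0) key
  simp only [coeff_single_mul_apply] at hc
  simpa [z, coeff_sub, Finsupp.single_apply] using hc.symm

end Transfer

/-! ### Connectedness -/

/-- If the units generate the additive group of `R`, the unitary Cayley graph is connected. -/
theorem unitaryCayleyGraph_connected_of_closure {R : Type*} [CommRing R] [Nontrivial R]
    (h : AddSubgroup.closure {x : R | IsUnit x} = ⊤) : (unitaryCayleyGraph R).Connected := by
  have key : ∀ x : R, ∀ y, (unitaryCayleyGraph R).Reachable y (y + x) := by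
    intro x
    have hx : x ∈ AddSubgroup.closure {x : R | IsUnit x} := h ▸ AddSubgroup.mem_top x
    induction hx using AddSubgroup.closure_induction with
    | mem x hx =>
      intro y
      refine SimpleGraph.Adj.reachable ((unitaryCayleyGraph_adj _ _).2 ?_)
      rw [sub_add_cancel_left]
      exact hx.neg
    | zero => simp
    | add x x' _ _ hx hx' =>
      intro y
      rw [← add_assoc]
      exact (hx y).trans (hx' _)
    | neg x _ hx =>
      intro y
      have := hx (y + -x)
      rw [neg_add_cancel_right] at this
      exact this.symm
  exact (SimpleGraph.connected_iff _).2 ⟨fun x y => by simpa using key (y - x) x, ⟨0⟩⟩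

theorem closure_isUnit_eq_top_of_surjective {R S : Type*} [CommRing R] [CommRing S] (φ : R →+* S)
    (hφ : Function.Surjective φ) (h : AddSubgroup.closure {x : R | IsUnit x} = ⊤) :
    AddSubgroup.closure {x : S | IsUnit x} = ⊤ := by
  rw [eq_top_iff]
  rintro y -
  obtain ⟨x, rfl⟩ := hφ y
  have hx : x ∈ AddSubgroup.closure {x : R | IsUnit x} := h ▸ AddSubgroup.mem_top x
  induction hx using AddSubgroup.closure_induction with
  | mem x hx => exact AddSubgroup.subset_closure (IsUnit.map φ hx)
  | zero => simp
  | add x x' _ _ hx hx' => rw [map_add]; exact add_mem hx hx'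
  | neg x _ hx => rw [map_neg]; exact neg_mem hx

theorem closure_isUnit_zmod (n : ℕ) : AddSubgroup.closure {x : ZMod n | IsUnit x} = ⊤ := by
  rw [eq_top_iff]
  rintro y -
  obtain ⟨k, rfl⟩ := ZMod.intCast_surjective y
  rw [← zsmul_one]
  exact AddSubgroup.zsmul_mem _ (AddSubgroup.subset_closure (by simp)) k

/-- Two distinct maximal ideals of index two disconnect the unitary Cayley graph. -/
theorem eq_of_connected_of_card_quotient_eq_two {R : Type*} [CommRing R] [Nontrivial R]
    (h : (unitaryCayleyGraph R).Connected) {M N : Ideal R} (hM : Nat.card (R ⧸ M) = 2)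
    (hN : Nat.card (R ⧸ N) = 2) : M = N := by
  have key : ∀ I : Ideal R, Nat.card (R ⧸ I) = 2 → ∀ x y, (unitaryCayleyGraph R).Adj x y →
      (y ∈ I ↔ x ∉ I) := by
    intro I hI x y hxy
    rw [unitaryCayleyGraph_adj] at hxy
    have : Finite (R ⧸ I) := Nat.finite_of_card_ne_zero (by omega)
    have := Fintype.ofFinite (R ⧸ I)
    have hnt : Nontrivial (R ⧸ I) := by
      rw [← Fintype.one_lt_card_iff_nontrivial, ← Nat.card_eq_fintype_card]
      omega
    have e := ZMod.ringEquivOfPrime (R ⧸ I) Nat.prime_two (by rw [← Nat.card_eq_fintype_card, hI])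
    have h2 : ∀ a b : R ⧸ I, a - b ≠ 0 → (b = 0 ↔ a ≠ 0) := by
      intro a b
      obtain ⟨a, rfl⟩ := e.surjective a
      obtain ⟨b, rfl⟩ := e.surjective b
      rw [← map_sub, map_ne_zero_iff _ e.injective, map_eq_zero_iff _ e.injective,
        map_ne_zero_iff _ e.injective]
      revert a b
      decide
    have := h2 (Ideal.Quotient.mk I x) (Ideal.Quotient.mk I y)
      (by rw [← map_sub]; exact (hxy.map (Ideal.Quotient.mk I)).ne_zero)
    rwa [ne_eq, Ideal.Quotient.eq_zero_iff_mem, Ideal.Quotient.eq_zero_iff_mem] at this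
  ext x
  -- Along a walk from 0, each edge flips membership in both ideals, so they agree at every vertex
  -- reached.
  have hx := (SimpleGraph.reachable_iff_reflTransGen _ _).1 (h.preconnected 0 x)
  induction hx with
  | refl => simp
  | tail _ hxy ih => exact (key M hM _ _ hxy).trans ((not_congr ih).trans (key N hN _ _ hxy).symm)

/-! ### Rings of order four and twelve -/

/-- A ring of order four with a nonzero element of square zero. -/
theorem ringEquiv_of_card_eq_four {B : Type*} [CommRing B] (hB : Nat.card B = 4) {w : B}
    (hw : w ≠ 0) (hw2 : w * w = 0) : Nonempty (B ≃+* ZMod 4) ∨ Nonempty (B ≃+* RingG2) := by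
  have : Finite B := Nat.finite_of_card_ne_zero (by omega)
  have := Fintype.ofFinite B
  rw [Nat.card_eq_fintype_card] at hB
  have : Nontrivial B := ⟨w, 0, hw⟩
  by_cases h2 : (2 : B) = 0
  · right
    have : CharP B 2 := CharTwo.of_one_ne_zero_of_two_eq_zero one_ne_zero h2
    let _ := ZMod.algebra B 2
    let f : RingG2 →ₐ[ZMod 2] B := DualNumber.lift
      ⟨(Algebra.ofId (ZMod 2) B, w), hw2, fun _ => Commute.all _ _⟩
    have hf : ∀ x, f x = algebraMap (ZMod 2) B x.fst + algebraMap (ZMod 2) B x.snd * w :=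
      fun x => DualNumber.lift_apply_apply _ x
    have hinj : Function.Injective f := by
      rw [injective_iff_map_eq_zero]
      intro x hx
      rw [hf] at hx
      have h01 : ∀ a : ZMod 2, a = 0 ∨ a = 1 := by decide
      rcases h01 x.fst with h0 | h1
      · rcases h01 x.snd with h0' | h1'
        · exact TrivSqZeroExt.ext h0 h0'
        · simp [h0, h1'] at hx
          exact absurd hx hw
      -- Multiplying `1 + s w = 0` by `w` gives `w = 0`.
      · refine absurd ?_ hw
        have := congrArg (· * w) hx
        simpa [h1, add_mul, mul_assoc, hw2] using this
    have : Finite RingG2 := Finite.of_injective f hinj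
    have := Fintype.ofFinite RingG2
    have hcard : Fintype.card RingG2 = 4 := by
      rw [← Nat.card_eq_fintype_card]
      change Nat.card (ZMod 2 × ZMod 2) = 4
      simp
    exact ⟨(RingEquiv.ofBijective f ((Fintype.bijective_iff_injective_and_card f).2
      ⟨hinj, by rw [hcard, hB]⟩)).symm⟩
  · left
    obtain ⟨n, hn⟩ := CharP.exists B
    have h4 : n ∣ 4 := (CharP.cast_eq_zero_iff B n 4).1 (by rw [← hB, Nat.cast_card_eq_zero])
    have h2' : ¬ n ∣ 2 := fun h => h2 (by exact_mod_cast (CharP.cast_eq_zero_iff B n 2).2 h)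
    have hle := Nat.le_of_dvd (by norm_num) h4
    have : n = 4 := by interval_cases n <;> simp_all
    subst this
    exact ⟨(ZMod.ringEquiv B hB).symm⟩

theorem not_dvd_card_of_natCast_eq_zero {A : Type*} [CommRing A] [Finite A] {k p : ℕ}
    (hk : (k : A) = 0) (hp : p.Prime) (hpk : ¬ p ∣ k) : ¬ p ∣ Nat.card A := by
  intro h
  have := Fintype.ofFinite A
  have := Fact.mk hp
  rw [Nat.card_eq_fintype_card, ← prime_dvd_char_iff_dvd_card] at h
  exact hpk (h.trans ((ringChar.spec A k).1 hk))

/-- A ring of order twelve is a product of a ring of order three and one of order four. -/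
theorem ringEquiv_of_card_eq_twelve {R : Type*} [CommRing R] (hR : Nat.card R = 12) {w : R}
    (hw : w ≠ 0) (hw2 : w * w = 0) (h2w : 2 * w = 0) :
    Nonempty (R ≃+* ZMod 12) ∨ Nonempty (R ≃+* ZMod 3 × RingG2) := by
  have : Finite R := Nat.finite_of_card_ne_zero (by omega)
  have h12 : (12 : R) = 0 := by
    have := Fintype.ofFinite R
    rw [Nat.card_eq_fintype_card] at hR
    simpa [hR] using Nat.cast_card_eq_zero R
  set I : Ideal R := Ideal.span {3} with hI
  set J : Ideal R := Ideal.span {4} with hJ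
  have hco : IsCoprime I J := (Ideal.isCoprime_span_singleton_iff _ _).2 ⟨-1, 1, by norm_num⟩
  have hinf : I ⊓ J = ⊥ := by
    rw [← Ideal.mul_eq_inf_of_isCoprime hco, hI, hJ, Ideal.span_singleton_mul_span_singleton,
      show (3 * 4 : R) = 12 by norm_num, h12, Ideal.span_singleton_eq_bot]
  let e : R ≃+* (R ⧸ I) × (R ⧸ J) := (RingEquiv.quotientBot R).symm.trans
    ((Ideal.quotEquivOfEq hinf.symm).trans (Ideal.quotientInfEquivQuotientProd I J hco))
  have hcard : Nat.card (R ⧸ I) * Nat.card (R ⧸ J) = 12 := by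
    rw [← Nat.card_prod, ← Nat.card_congr e.toEquiv, hR]
  have hI3 : ((3 : ℕ) : R ⧸ I) = 0 := by
    rw [← map_natCast (Ideal.Quotient.mk I), Ideal.Quotient.eq_zero_iff_mem]
    exact_mod_cast Ideal.mem_span_singleton_self _
  have hJ4 : ((4 : ℕ) : R ⧸ J) = 0 := by
    rw [← map_natCast (Ideal.Quotient.mk J), Ideal.Quotient.eq_zero_iff_mem]
    exact_mod_cast Ideal.mem_span_singleton_self _
  have : Finite (R ⧸ I) := Finite.of_surjective _ Ideal.Quotient.mk_surjective
  have : Finite (R ⧸ J) := Finite.of_surjective _ Ideal.Quotient.mk_surjective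
  have hI2 := not_dvd_card_of_natCast_eq_zero hI3 Nat.prime_two (by norm_num)
  have hJ3 := not_dvd_card_of_natCast_eq_zero hJ4 Nat.prime_three (by norm_num)
  have hcards : Nat.card (R ⧸ I) = 3 ∧ Nat.card (R ⧸ J) = 4 := by
    have h1 : Nat.card (R ⧸ I) ∣ 12 := ⟨_, hcard.symm⟩
    have h2 := Nat.le_of_dvd (by norm_num) h1
    generalize Nat.card (R ⧸ I) = a at *
    generalize Nat.card (R ⧸ J) = b at *
    interval_cases a <;> omega
  have e3 : Nonempty (R ⧸ I ≃+* ZMod 3) := by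
    have := Fintype.ofFinite (R ⧸ I)
    exact ⟨(ZMod.ringEquivOfPrime (R ⧸ I) Nat.prime_three
      (by rw [← Nat.card_eq_fintype_card, hcards.1])).symm⟩
  obtain ⟨e3⟩ := e3
  have hwJ : Ideal.Quotient.mk J w ≠ 0 := by
    rw [ne_eq, Ideal.Quotient.eq_zero_iff_mem, hJ, Ideal.mem_span_singleton]
    rintro ⟨x, hx⟩
    -- If `w = 4x` then `3w = 12x = 0`, which with `2w = 0` gives `w = 0`.
    exact hw (by linear_combination 3 * hx + x * h12 - h2w)
  rcases ringEquiv_of_card_eq_four hcards.2 hwJ (by rw [← map_mul, hw2, map_zero]) with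
    ⟨⟨e4⟩⟩ | ⟨⟨e4⟩⟩
  · exact Or.inl ⟨e.trans ((RingEquiv.prodCongr e3 e4).trans
      (ZMod.chineseRemainder (m := 3) (n := 4) (by norm_num)).symm)⟩
  · exact Or.inr ⟨e.trans (RingEquiv.prodCongr e3 e4)⟩

/-! ### Maximal ideals, the Jacobson radical and the classification -/

section Classification

theorem Ideal.IsMaximal.isUnit_quotient {R : Type*} [CommRing R] {M : Ideal R} (hM : M.IsMaximal)
    (x : R ⧸ M) (hx : x ≠ 0) : IsUnit x := by
  let _ := Ideal.Quotient.field M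
  exact hx.isUnit

theorem Ideal.IsMaximal.card_units_quotient {R : Type*} [CommRing R] [Finite R] {M : Ideal R}
    (hM : M.IsMaximal) [Fintype (R ⧸ M)ˣ] :
    Fintype.card (R ⧸ M)ˣ + 1 = Nat.card (R ⧸ M) := by
  let _ := Ideal.Quotient.field M
  have : Finite (R ⧸ M) := Finite.of_surjective _ Ideal.Quotient.mk_surjective
  rw [Nat.card_eq_card_units_add_one, Nat.card_eq_fintype_card]

variable {R : Type*} [CommRing R] [Fintype Rˣ] {n : ℕ} {w : R} {γ : ℂ}

theorem ne_zero_of_aeval_unitAverage (hw : w ≠ 0)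
    (h : Polynomial.aeval (unitAverage R) (Polynomial.Chebyshev.T ℂ n) = single w γ) : n ≠ 0 := by
  rintro rfl
  have := congrArg (fun z => z.coeff 0) h
  simp [one_def, hw] at this

theorem card_quotient_of_isMaximal [Finite R] (hw : w ≠ 0) (hγ : ‖γ‖ = 1)
    (h : Polynomial.aeval (unitAverage R) (Polynomial.Chebyshev.T ℂ n) = single w γ)
    {M : Ideal R} (hM : M.IsMaximal) :
    Nat.card (R ⧸ M) = 2 ∨ (Nat.card (R ⧸ M) = 3 ∧ w ∈ M) := by
  have : Finite (R ⧸ M) := Finite.of_surjective _ Ideal.Quotient.mk_surjective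
  have := Fintype.ofFinite (R ⧸ M)ˣ
  have : Nontrivial (R ⧸ M) := Ideal.Quotient.nontrivial_iff.2 hM.ne_top
  have hc := hM.card_units_quotient
  have hpos : 0 < Fintype.card (R ⧸ M)ˣ := Fintype.card_pos
  by_cases hcard : 2 < Nat.card (R ⧸ M)
  · right
    obtain ⟨h1, h2⟩ := eval_eq_of_isUnit_of_ne_zero hM.isUnit_quotient hcard hγ
      (aeval_unitAverage_map h (Ideal.Quotient.mk M) Ideal.Quotient.mk_surjective)
    obtain ⟨k, hk⟩ := Polynomial.Chebyshev.exists_int_of_norm_eval_T_eq_one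
      (ne_zero_of_aeval_unitAverage hw h) (μ := -(Fintype.card (R ⧸ M)ˣ : ℚ)⁻¹)
      (by push_cast; rw [h2, hγ])
    -- Integrality of `-2/(q - 1)` means that `q - 1` divides 2.
    have hk2 : -k * (Fintype.card (R ⧸ M)ˣ : ℤ) = 2 := by
      have : (Fintype.card (R ⧸ M)ˣ : ℚ) ≠ 0 := by exact_mod_cast hpos.ne'
      have h3 : -(k : ℚ) * (Fintype.card (R ⧸ M)ˣ : ℚ) = 2 := by
        rw [hk]
        field_simp
      exact_mod_cast h3
    have hle := Int.le_of_dvd two_pos (Dvd.intro_left _ hk2)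
    exact ⟨by omega, Ideal.Quotient.eq_zero_iff_mem.1 h1⟩
  · left
    omega

theorem eq_of_card_quotient_eq_three [Finite R] (hw : w ≠ 0) (hγ : ‖γ‖ = 1)
    (h : Polynomial.aeval (unitAverage R) (Polynomial.Chebyshev.T ℂ n) = single w γ)
    {M N : Ideal R} (hM : M.IsMaximal) (hN : N.IsMaximal)
    (hM3 : Nat.card (R ⧸ M) = 3) (hN3 : Nat.card (R ⧸ N) = 3) : M = N := by
  by_contra hMN
  have hwM : w ∈ M := ((card_quotient_of_isMaximal hw hγ h hM).resolve_left (by omega)).2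
  have hwN : w ∈ N := ((card_quotient_of_isMaximal hw hγ h hN).resolve_left (by omega)).2
  have : Nontrivial (R ⧸ M) := Ideal.Quotient.nontrivial_iff.2 hM.ne_top
  have : Nontrivial (R ⧸ N) := Ideal.Quotient.nontrivial_iff.2 hN.ne_top
  have : Finite (R ⧸ M) := Finite.of_surjective _ Ideal.Quotient.mk_surjective
  have : Finite (R ⧸ N) := Finite.of_surjective _ Ideal.Quotient.mk_surjective
  have := Fintype.ofFinite (R ⧸ M)ˣ
  have := Fintype.ofFinite (R ⧸ N)ˣ
  have := Fintype.ofFinite ((R ⧸ M) × (R ⧸ N))ˣ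
  let e := Ideal.quotientInfEquivQuotientProd M N (Ideal.isCoprime_of_isMaximal hMN)
  let φ : R →+* (R ⧸ M) × (R ⧸ N) := (e : R ⧸ M ⊓ N →+* (R ⧸ M) × (R ⧸ N)).comp
    (Ideal.Quotient.mk (M ⊓ N))
  have hφ : Function.Surjective φ := e.surjective.comp Ideal.Quotient.mk_surjective
  have hφw : φ w = 0 := by
    change e (Ideal.Quotient.mk (M ⊓ N) w) = 0
    rw [Ideal.Quotient.eq_zero_iff_mem.2 (Ideal.mem_inf.2 ⟨hwM, hwN⟩), map_zero]
  have h1 := aeval_unitAverage_map h φ hφ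
  rw [hφw] at h1
  have h2 := eval_eq_of_prod hM.isUnit_quotient hN.isUnit_quotient h1
  have hcM := hM.card_units_quotient
  have hcN := hN.card_units_quotient
  have hc : Fintype.card ((R ⧸ M) × (R ⧸ N))ˣ = 4 := by
    rw [Fintype.card_congr MulEquiv.prodUnits.toEquiv, Fintype.card_prod,
      show Fintype.card (R ⧸ M)ˣ = 2 by omega, show Fintype.card (R ⧸ N)ˣ = 2 by omega]
  rw [hc] at h2
  obtain ⟨k, hk⟩ := Polynomial.Chebyshev.exists_int_of_norm_eval_T_eq_one
    (ne_zero_of_aeval_unitAverage hw h) (μ := (4 : ℚ)⁻¹)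
    (by push_cast at h2 ⊢; rw [h2, hγ])
  have h4 : (2 * k : ℚ) = 1 := by rw [hk]; norm_num
  have h5 : 2 * k = 1 := by exact_mod_cast h4
  omega

/-- The elements common to all maximal ideals of `R` are at most `0` and `w`. -/
theorem eq_of_forall_mem_isMaximal (hw : w ≠ 0) (hγ : ‖γ‖ = 1)
    (h : Polynomial.aeval (unitAverage R) (Polynomial.Chebyshev.T ℂ n) = single w γ)
    {j : R} (hj0 : j ≠ 0) (hj : ∀ M : Ideal R, M.IsMaximal → j ∈ M) : j = w := by
  have key : ∀ x i : R, (∀ M : Ideal R, M.IsMaximal → i ∈ M) → IsUnit x → IsUnit (x - i) := by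
    intro x i hi hx
    by_contra hu
    obtain ⟨M, hM, hxM⟩ := exists_max_ideal_of_mem_nonunits hu
    exact hM.ne_top (M.eq_top_of_isUnit_mem ((sub_add_cancel x i) ▸ M.add_mem hxM (hi M hM)) hx)
  refine eq_of_add_isUnit_iff hw hγ h hj0 fun x => ⟨fun hx => ?_, key x j hj⟩
  simpa using key (x - j) (-j) (fun M hM => M.neg_mem (hj M hM)) hx

/-- Otherwise `w²` is a nonzero element of the radical, so `w² = w`; but `1 - w` is a unit. -/
theorem mul_self_eq_zero_of_forall_mem_isMaximal (hw : w ≠ 0) (hγ : ‖γ‖ = 1)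
    (h : Polynomial.aeval (unitAverage R) (Polynomial.Chebyshev.T ℂ n) = single w γ)
    (hwJ : ∀ M : Ideal R, M.IsMaximal → w ∈ M) : w * w = 0 := by
  by_contra hww
  have h1 := eq_of_forall_mem_isMaximal hw hγ h hww (fun M hM => M.mul_mem_left w (hwJ M hM))
  have hu : IsUnit (1 - w) := by
    by_contra hu
    obtain ⟨M, hM, hxM⟩ := exists_max_ideal_of_mem_nonunits hu
    exact hM.ne_top (M.eq_top_iff_one.2 ((sub_add_cancel 1 w) ▸ M.add_mem hxM (hwJ M hM)))
  exact hw (hu.mul_left_eq_zero.1 (by linear_combination -h1))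

theorem two_mul_eq_zero_of_forall_mem_isMaximal (hw : w ≠ 0) (hγ : ‖γ‖ = 1)
    (h : Polynomial.aeval (unitAverage R) (Polynomial.Chebyshev.T ℂ n) = single w γ)
    (hwJ : ∀ M : Ideal R, M.IsMaximal → w ∈ M) : 2 * w = 0 := by
  have h1 := eq_of_forall_mem_isMaximal hw hγ h (neg_ne_zero.2 hw)
    (fun M hM => M.neg_mem (hwJ M hM))
  linear_combination -h1

theorem card_eq_one_or_two_of_mem_iff (hw : w ≠ 0) (hγ : ‖γ‖ = 1)
    (h : Polynomial.aeval (unitAverage R) (Polynomial.Chebyshev.T ℂ n) = single w γ)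
    {J : Ideal R} (hJ : ∀ x, x ∈ J ↔ ∀ M : Ideal R, M.IsMaximal → x ∈ M) :
    J = ⊥ ∨ (w ∈ J ∧ Nat.card J = 2) := by
  by_cases hbot : J = ⊥
  · exact Or.inl hbot
  · right
    obtain ⟨j, hj, hj0⟩ := (Submodule.ne_bot_iff J).1 hbot
    have hwJ : w ∈ J := eq_of_forall_mem_isMaximal hw hγ h hj0 ((hJ j).1 hj) ▸ hj
    have hset : (J : Set R) = {0, w} := by
      ext x
      simp only [SetLike.mem_coe, Set.mem_insert_iff, Set.mem_singleton_iff]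
      constructor
      · intro hx
        by_cases hx0 : x = 0
        · exact Or.inl hx0
        · exact Or.inr (eq_of_forall_mem_isMaximal hw hγ h hx0 ((hJ x).1 hx))
      · rintro (rfl | rfl)
        exacts [J.zero_mem, hwJ]
    refine ⟨hwJ, ?_⟩
    change Nat.card (J : Set R) = 2
    rw [hset, Nat.card_coe_set_eq, Set.ncard_pair hw.symm]

theorem ringEquiv_of_aeval_unitAverage [Finite R] [Nontrivial R] (hconn : (unitaryCayleyGraph R).Connected)
    (hw : w ≠ 0) (hγ : ‖γ‖ = 1)
    (h : Polynomial.aeval (unitAverage R) (Polynomial.Chebyshev.T ℂ n) = single w γ) :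
    Nonempty (R ≃+* ZMod 2) ∨ Nonempty (R ≃+* ZMod 4) ∨ Nonempty (R ≃+* RingG2) ∨
      Nonempty (R ≃+* ZMod 6) ∨ Nonempty (R ≃+* ZMod 12) ∨ Nonempty (R ≃+* ZMod 3 × RingG2) := by
  have hmax := fun (M : Ideal R) (hM : M.IsMaximal) => card_quotient_of_isMaximal hw hγ h hM
  have zmodEquiv : ∀ {S : Type _} [CommRing S] {p : ℕ}, p.Prime → Nat.card S = p →
      Nonempty (S ≃+* ZMod p) := by
    intro S _ p hp hS
    have : Finite S := Nat.finite_of_card_ne_zero (hS ▸ hp.ne_zero)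
    have := Fintype.ofFinite S
    exact ⟨(ZMod.ringEquivOfPrime S hp (by rw [← Nat.card_eq_fintype_card, hS])).symm⟩
  by_cases h2 : ∃ M : Ideal R, M.IsMaximal ∧ Nat.card (R ⧸ M) = 2
  · obtain ⟨M, hM, hM2⟩ := h2
    by_cases h3 : ∃ N : Ideal R, N.IsMaximal ∧ Nat.card (R ⧸ N) = 3
    · obtain ⟨N, hN, hN3⟩ := h3
      have hMN : M ≠ N := by
        rintro rfl
        omega
      have hJ : ∀ x, x ∈ M ⊓ N ↔ ∀ I : Ideal R, I.IsMaximal → x ∈ I := by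
        refine fun x => ⟨fun hx I hI => ?_, fun hx => ⟨hx M hM, hx N hN⟩⟩
        rcases hmax I hI with h' | ⟨h', -⟩
        · exact eq_of_connected_of_card_quotient_eq_two hconn hM2 h' ▸ hx.1
        · exact eq_of_card_quotient_eq_three hw hγ h hN hI hN3 h' ▸ hx.2
      let e := Ideal.quotientInfEquivQuotientProd M N (Ideal.isCoprime_of_isMaximal hMN)
      rcases card_eq_one_or_two_of_mem_iff hw hγ h hJ with hbot | ⟨hwJ, hcard⟩
      · obtain ⟨e2⟩ := zmodEquiv Nat.prime_two hM2
        obtain ⟨e3⟩ := zmodEquiv Nat.prime_three hN3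
        exact Or.inr <| Or.inr <| Or.inr <| Or.inl ⟨(RingEquiv.quotientBot R).symm.trans
          ((Ideal.quotEquivOfEq hbot.symm).trans (e.trans ((RingEquiv.prodCongr e2 e3).trans
            (ZMod.chineseRemainder (m := 2) (n := 3) (by norm_num)).symm)))⟩
      · have hR : Nat.card R = 12 := by
          rw [Submodule.card_eq_card_quotient_mul_card (M ⊓ N), hcard, Nat.card_congr e.toEquiv,
            Nat.card_prod, hM2, hN3]
        exact Or.inr <| Or.inr <| Or.inr <| Or.inr <| ringEquiv_of_card_eq_twelve hR hw
          (mul_self_eq_zero_of_forall_mem_isMaximal hw hγ h ((hJ w).1 hwJ))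
          (two_mul_eq_zero_of_forall_mem_isMaximal hw hγ h ((hJ w).1 hwJ))
    · have hJ : ∀ x, x ∈ M ↔ ∀ I : Ideal R, I.IsMaximal → x ∈ I := by
        refine fun x => ⟨fun hx I hI => ?_, fun hx => hx M hM⟩
        rcases hmax I hI with h' | ⟨h', -⟩
        · exact eq_of_connected_of_card_quotient_eq_two hconn hM2 h' ▸ hx
        · exact absurd ⟨I, hI, h'⟩ h3
      rcases card_eq_one_or_two_of_mem_iff hw hγ h hJ with hbot | ⟨hwJ, hcard⟩
      · obtain ⟨e2⟩ := zmodEquiv Nat.prime_two hM2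
        exact Or.inl ⟨(RingEquiv.quotientBot R).symm.trans
          ((Ideal.quotEquivOfEq hbot.symm).trans e2)⟩
      · have hR : Nat.card R = 4 := by
          rw [Submodule.card_eq_card_quotient_mul_card M, hcard, hM2]
        rcases ringEquiv_of_card_eq_four hR hw
          (mul_self_eq_zero_of_forall_mem_isMaximal hw hγ h ((hJ w).1 hwJ)) with h' | h'
        exacts [Or.inr (Or.inl h'), Or.inr (Or.inr (Or.inl h'))]
  · exfalso
    push Not at h2
    have hwJ : ∀ I : Ideal R, I.IsMaximal → w ∈ I :=
      fun I hI => ((hmax I hI).resolve_left (h2 I hI)).2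
    have h2w := two_mul_eq_zero_of_forall_mem_isMaximal hw hγ h hwJ
    have hu : IsUnit (2 : R) := by
      by_contra hu
      obtain ⟨M, hM, h2M⟩ := exists_max_ideal_of_mem_nonunits hu
      have hM3 := ((hmax M hM).resolve_left (h2 M hM)).1
      have h3M : (3 : R) ∈ M := by
        have : Finite (R ⧸ M) := Finite.of_surjective _ Ideal.Quotient.mk_surjective
        have := Fintype.ofFinite (R ⧸ M)
        have h3 := Nat.cast_card_eq_zero (R ⧸ M)
        rw [← Nat.card_eq_fintype_card, hM3, ← map_natCast (Ideal.Quotient.mk M),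
          Ideal.Quotient.eq_zero_iff_mem] at h3
        exact_mod_cast h3
      refine hM.ne_top (M.eq_top_iff_one.2 ?_)
      have := M.sub_mem h3M h2M
      norm_num at this
      exact this
    exact hw (hu.mul_right_eq_zero.1 h2w)

end Classification

/-! ### Explicit transfer in the six rings -/

theorem aeval_T_three {A : Type*} [CommRing A] [Algebra ℂ A] (p : A) :
    Polynomial.aeval p (Polynomial.Chebyshev.T ℂ (3 : ℕ)) = 4 * p ^ 3 - 3 * p := by
  rw [Polynomial.Chebyshev.aeval_T, show ((3 : ℕ) : ℤ) = 1 + 2 by norm_num,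
    Polynomial.Chebyshev.T_add_two, show (1 + 1 : ℤ) = 2 by norm_num,
    Polynomial.Chebyshev.T_two]
  simp
  ring

theorem aeval_T_two {A : Type*} [CommRing A] [Algebra ℂ A] (p : A) :
    Polynomial.aeval p (Polynomial.Chebyshev.T ℂ (2 : ℕ)) = 2 * p ^ 2 - 1 := by
  rw [Polynomial.Chebyshev.aeval_T, Nat.cast_ofNat, Polynomial.Chebyshev.T_two]
  simp

theorem aeval_T_six {A : Type*} [CommRing A] [Algebra ℂ A] (p : A) :
    Polynomial.aeval p (Polynomial.Chebyshev.T ℂ (6 : ℕ)) = 2 * (4 * p ^ 3 - 3 * p) ^ 2 - 1 := by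
  rw [show ((6 : ℕ) : ℤ) = (2 : ℕ) * (3 : ℕ) by norm_num, Polynomial.Chebyshev.T_mul,
    Polynomial.aeval_comp, aeval_T_three, aeval_T_two]

/-- The argument squares to `(1 + σ)/2`. The condition on `b` covers both `b² = σ`, as in `ZMod 4`,
and `b² = 1`, as in `RingG2`. -/
theorem aeval_T_two_eq {A : Type*} [CommRing A] [Algebra ℂ A] {b σ : A} (hσ : σ ^ 2 = 1)
    (hb : b ^ 2 * (1 + σ) = 1 + σ) :
    Polynomial.aeval ((2 : ℂ)⁻¹ • (b + b * σ)) (Polynomial.Chebyshev.T ℂ (2 : ℕ)) = σ := by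
  have hi : 2 * algebraMap ℂ A 2⁻¹ = 1 := by
    rw [← map_ofNat (algebraMap ℂ A), ← map_mul]
    simp
  rw [aeval_T_two, Algebra.smul_def]
  generalize algebraMap ℂ A 2⁻¹ = i at hi
  linear_combination 2 * i ^ 2 * (1 + σ) * hb + 2 * i ^ 2 * hσ + (2 * i + 1) * (1 + σ) * hi

/-- As `x⁵ = x⁻¹`, this is `T_3((x + x⁻¹)/2) = (x³ + x⁻³)/2` with `x³ = x⁻³`. -/
theorem aeval_T_three_eq {A : Type*} [CommRing A] [Algebra ℂ A] {x : A} (hx : x ^ 6 = 1) :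
    Polynomial.aeval ((2 : ℂ)⁻¹ • (x + x ^ 5)) (Polynomial.Chebyshev.T ℂ (3 : ℕ)) = x ^ 3 := by
  have hi : 2 * algebraMap ℂ A 2⁻¹ = 1 := by
    rw [← map_ofNat (algebraMap ℂ A), ← map_mul]
    simp
  rw [aeval_T_three, Algebra.smul_def]
  generalize algebraMap ℂ A 2⁻¹ = i at hi
  have h3 : (x + x ^ 5) ^ 3 = 2 * x ^ 3 + 3 * (x + x ^ 5) := by
    linear_combination (3 * x + 3 * x ^ 5 + x ^ 9 + x ^ 3) * hx
  linear_combination 4 * i ^ 3 * h3 + (i * (2 * i + 1) * (2 * x ^ 3 + 3 * (x + x ^ 5)) + x ^ 3) * hi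

theorem aeval_T_six_eq {A : Type*} [CommRing A] [Algebra ℂ A] {a b σ : A} (ha : a ^ 3 = 1)
    (hσ : σ ^ 2 = 1) (hb : b ^ 2 * (1 + σ) = 1 + σ) :
    Polynomial.aeval ((4 : ℂ)⁻¹ • ((a + a ^ 2) * (b + b * σ)))
      (Polynomial.Chebyshev.T ℂ (6 : ℕ)) = σ := by
  have hi : 4 * algebraMap ℂ A 4⁻¹ = 1 := by
    rw [← map_ofNat (algebraMap ℂ A), ← map_mul]
    simp
  rw [aeval_T_six, Algebra.smul_def]
  generalize algebraMap ℂ A 4⁻¹ = i at hi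
  obtain ⟨s, hs⟩ : ∃ s, s = a + a ^ 2 := ⟨_, rfl⟩
  have hs2 : s ^ 2 = s + 2 := by rw [hs]; linear_combination (2 + a) * ha
  obtain ⟨t, ht⟩ : ∃ t, t = b + b * σ := ⟨_, rfl⟩
  have ht2 : t ^ 2 = 2 * (1 + σ) := by rw [ht]; linear_combination (1 + σ) * hb + hσ
  have ht3 : t ^ 3 = 4 * t := by
    rw [pow_succ, ht2, ht]
    linear_combination 2 * b * hσ
  have hs3 : s ^ 3 = 3 * s + 2 := by linear_combination (s + 1) * hs2
  rw [← hs, ← ht]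
  -- The relations put `s/2` in `{1, -1/2}` and `t/2` in `{0, 1, -1}`. As `T_3` is odd and equals 1
  -- at both 1 and `-1/2`, it sends `st/4` to `t/2`; then `T_2(t/2) = σ`.
  have h3 : 4 * (i * (s * t)) ^ 3 - 3 * (i * (s * t)) = 2 * i * t := by
    linear_combination 4 * i ^ 3 * t ^ 3 * hs3 + 4 * i ^ 3 * (3 * s + 2) * ht3 +
      i * (4 * i + 1) * (3 * s + 2) * t * hi
  rw [h3]
  linear_combination 8 * i ^ 2 * ht2 + (4 * i + 1) * (1 + σ) * hi

theorem unitAverage_eq_sum {R : Type*} [CommRing R] [Fintype Rˣ] (s : Finset R)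
    (hs : ∀ x, x ∈ s ↔ ∃ y, x * y = 1) :
    unitAverage R = (s.card : ℂ)⁻¹ • ∑ x ∈ s, single x 1 := by
  have hs' : s = Finset.univ.map ⟨((↑) : Rˣ → R), Units.val_injective⟩ := by
    ext x
    rw [hs, ← isUnit_iff_exists_inv]
    simp [IsUnit]
  rw [unitAverage, hs', Finset.card_map, Finset.sum_map, Finset.card_univ]
  rfl

/-- Connectedness and state transfer along a ring isomorphism. -/
theorem connected_and_exhibitsPST_of_ringEquiv {R X : Type*} [CommRing R] [Nontrivial R] [Fintype R]
    [DecidableEq R] [DecidableRel (unitaryCayleyGraph R).Adj] [CommRing X] [Finite X]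
    [Fintype Xˣ] {n : ℕ} {w : X} (hX : AddSubgroup.closure {x : X | IsUnit x} = ⊤) (hw : w ≠ 0)
    (h : Polynomial.aeval (unitAverage X) (Polynomial.Chebyshev.T ℂ n) = single w 1)
    (e : R ≃+* X) :
    (unitaryCayleyGraph R).Connected ∧ GroverWalk.ExhibitsPST (unitaryCayleyGraph R) :=
  ⟨unitaryCayleyGraph_connected_of_closure
      (closure_isUnit_eq_top_of_surjective (e.symm : X →+* R) e.symm.surjective hX),
    exhibitsPST_of_aeval_unitAverage ((map_ne_zero_iff _ e.symm.injective).2 hw)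
      (aeval_unitAverage_map h (e.symm : X →+* R) e.symm.surjective)⟩

theorem aeval_unitAverage_zmod_two :
    Polynomial.aeval (unitAverage (ZMod 2)) (Polynomial.Chebyshev.T ℂ (1 : ℕ)) = single 1 1 := by
  rw [unitAverage_eq_sum {1} (by decide)]
  simp

theorem aeval_unitAverage_zmod_four :
    Polynomial.aeval (unitAverage (ZMod 4)) (Polynomial.Chebyshev.T ℂ (2 : ℕ)) = single 2 1 := by
  rw [unitAverage_eq_sum {1, 3} (by decide)]
  have := aeval_T_two_eq (A := AddMonoidAlgebra ℂ (ZMod 4)) (b := single 1 1) (σ := single 2 1)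
    (by rw [sq, single_mul_single, one_def, mul_one]; rfl)
    (by
      rw [mul_add, mul_one, sq, single_mul_single, single_mul_single, one_def, mul_one, mul_one,
        add_comm]
      rfl)
  rw [single_mul_single, mul_one] at this
  rw [Finset.sum_pair (by decide), Finset.card_pair (by decide)]
  exact this

theorem aeval_unitAverage_zmod_six :
    Polynomial.aeval (unitAverage (ZMod 6)) (Polynomial.Chebyshev.T ℂ (3 : ℕ)) = single 3 1 := by
  rw [unitAverage_eq_sum {1, 5} (by decide)]
  have hpow : ∀ k : ℕ, (single (1 : ZMod 6) (1 : ℂ)) ^ k = single (k : ZMod 6) 1 := fun k => by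
    rw [single_pow]
    simp
  have := aeval_T_three_eq (x := single (1 : ZMod 6) (1 : ℂ)) (by rw [hpow]; rfl)
  rw [hpow, hpow] at this
  rw [Finset.sum_pair (by decide), Finset.card_pair (by decide)]
  exact this

theorem aeval_unitAverage_zmod_twelve :
    Polynomial.aeval (unitAverage (ZMod 12)) (Polynomial.Chebyshev.T ℂ (6 : ℕ)) = single 6 1 := by
  rw [unitAverage_eq_sum {1, 5, 7, 11} (by decide)]
  -- Under the Chinese remainder theorem 4, 9 and 6 are `(1, 0)`, `(0, 1)` and `(0, 2)` in `ZMod 3 ×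
  -- ZMod 4`.
  have := aeval_T_six_eq (A := AddMonoidAlgebra ℂ (ZMod 12)) (a := single 4 1) (b := single 9 1)
    (σ := single 6 1) (by rw [single_pow, one_pow]; rfl)
    (by rw [single_pow, one_pow]; rfl)
    (by
      rw [mul_add, mul_one, single_pow, one_pow, single_mul_single, one_def, mul_one, add_comm]
      rfl)
  have h : (single (4 : ZMod 12) (1 : ℂ) + single 4 1 ^ 2) * (single 9 1 + single 9 1 * single 6 1) =
      single 1 1 + (single 5 1 + (single 7 1 + single 11 1)) := by
    simp only [single_pow, one_pow, mul_add, add_mul, single_mul_single, mul_one]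
    rw [show (4 + 9 : ZMod 12) = 1 by decide, show (2 • 4 + 9 : ZMod 12) = 5 by decide,
      show (4 + (9 + 6) : ZMod 12) = 7 by decide, show (2 • 4 + (9 + 6) : ZMod 12) = 11 by decide]
    abel
  rw [h] at this
  rw [Finset.sum_insert (by decide), Finset.sum_insert (by decide), Finset.sum_pair (by decide)]
  exact this

instance : DecidableEq RingG2 := inferInstanceAs (DecidableEq (ZMod 2 × ZMod 2))

instance : Fintype RingG2 := inferInstanceAs (Fintype (ZMod 2 × ZMod 2))

theorem aeval_unitAverage_ringG2 [Fintype RingG2ˣ] :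
    Polynomial.aeval (unitAverage RingG2) (Polynomial.Chebyshev.T ℂ (2 : ℕ)) =
      single DualNumber.eps 1 := by
  have := aeval_T_two_eq (A := AddMonoidAlgebra ℂ RingG2) (b := single 1 1)
    (σ := single DualNumber.eps 1)
    (by rw [sq, single_mul_single, one_def, mul_one]; congr 1)
    (by
      rw [sq, single_mul_single, mul_one, show (1 + 1 : RingG2) = 0 by decide, ← one_def, one_mul])
  rw [single_mul_single, mul_one] at this
  rw [unitAverage_eq_sum {1, 1 + DualNumber.eps} (by decide), Finset.sum_pair (by decide),
    Finset.card_pair (by decide)]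
  exact this

theorem aeval_unitAverage_zmod_three_prod_ringG2 [Fintype (ZMod 3 × RingG2)ˣ] :
    Polynomial.aeval (unitAverage (ZMod 3 × RingG2)) (Polynomial.Chebyshev.T ℂ (6 : ℕ)) =
      single (0, DualNumber.eps) 1 := by
  have := aeval_T_six_eq (A := AddMonoidAlgebra ℂ (ZMod 3 × RingG2)) (a := single (1, 0) 1)
    (b := single (0, 1) 1) (σ := single (0, DualNumber.eps) 1)
    (by rw [single_pow, one_pow, one_def]; congr 1)
    (by rw [single_pow, one_pow, one_def]; congr 1)
    (by
      rw [single_pow, one_pow, show (2 • (0, 1) : ZMod 3 × RingG2) = 0 by decide, ← one_def,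
        one_mul])
  have h : (single ((1, 0) : ZMod 3 × RingG2) (1 : ℂ) + single (1, 0) 1 ^ 2) *
      (single (0, 1) 1 + single (0, 1) 1 * single (0, DualNumber.eps) 1) =
      single (1, 1) 1 + (single (2, 1) 1 + (single (1, 1 + DualNumber.eps) 1 +
        single (2, 1 + DualNumber.eps) 1)) := by
    simp only [single_pow, one_pow, mul_add, add_mul, single_mul_single, mul_one]
    rw [show ((1, 0) + (0, 1) : ZMod 3 × RingG2) = (1, 1) by decide,
      show (2 • (1, 0) + (0, 1) : ZMod 3 × RingG2) = (2, 1) by decide,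
      show ((1, 0) + ((0, 1) + (0, DualNumber.eps)) : ZMod 3 × RingG2) =
        (1, 1 + DualNumber.eps) by decide,
      show (2 • (1, 0) + ((0, 1) + (0, DualNumber.eps)) : ZMod 3 × RingG2) =
        (2, 1 + DualNumber.eps) by decide]
    abel
  rw [h] at this
  rw [unitAverage_eq_sum {(1, 1), (2, 1), (1, 1 + DualNumber.eps), (2, 1 + DualNumber.eps)}
    (by decide), Finset.sum_insert (by decide), Finset.sum_insert (by decide),
    Finset.sum_pair (by decide)]
  exact this

/-- Both `1` and `1 + z` are units, so `z` is a difference of units. The bounds 6 and 2 are the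
additive orders of `1` and `z` in `ZMod 3 × RingG2`, and keep the hypothesis decidable. -/
theorem closure_isUnit_eq_top_of_forall_eq {X : Type*} [CommRing X] {z u : X} (hz : (1 + z) * u = 1)
    (h : ∀ x : X, ∃ i : Fin 6, ∃ j : Fin 2, x = (i : ℕ) • 1 + (j : ℕ) • z) :
    AddSubgroup.closure {x : X | IsUnit x} = ⊤ := by
  rw [eq_top_iff]
  rintro x -
  obtain ⟨i, j, rfl⟩ := h x
  have h1 : (1 : X) ∈ AddSubgroup.closure {x : X | IsUnit x} :=
    AddSubgroup.subset_closure isUnit_one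
  have h2 : (1 + z : X) ∈ AddSubgroup.closure {x : X | IsUnit x} :=
    AddSubgroup.subset_closure (IsUnit.of_mul_eq_one u hz)
  have h3 : z ∈ AddSubgroup.closure {x : X | IsUnit x} := by
    simpa using sub_mem h2 h1
  exact add_mem (nsmul_mem h1 _) (nsmul_mem h3 _)

theorem closure_isUnit_ringG2 : AddSubgroup.closure {x : RingG2 | IsUnit x} = ⊤ :=
  closure_isUnit_eq_top_of_forall_eq (z := DualNumber.eps) (u := 1 + DualNumber.eps)
    (by decide) (by decide)

theorem closure_isUnit_zmod_three_prod_ringG2 :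
    AddSubgroup.closure {x : ZMod 3 × RingG2 | IsUnit x} = ⊤ :=
  closure_isUnit_eq_top_of_forall_eq (z := (0, DualNumber.eps)) (u := (1, 1 + DualNumber.eps))
    (by decide) (by decide)

theorem theorem4p5 {R : Type*} [CommRing R] [Nontrivial R] [Fintype R] [DecidableEq R]
    [DecidableRel (unitaryCayleyGraph R).Adj] :
    ((unitaryCayleyGraph R).Connected ∧ GroverWalk.ExhibitsPST (unitaryCayleyGraph R)) ↔
      (Nonempty (R ≃+* ZMod 2) ∨ Nonempty (R ≃+* ZMod 4) ∨ Nonempty (R ≃+* RingG2) ∨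
        Nonempty (R ≃+* ZMod 6) ∨ Nonempty (R ≃+* ZMod 12) ∨
        Nonempty (R ≃+* ZMod 3 × RingG2)) := by
  constructor
  · rintro ⟨hconn, hpst⟩
    obtain ⟨n, w, γ, hw, hγ, h⟩ := aeval_unitAverage_of_exhibitsPST hpst
    exact ringEquiv_of_aeval_unitAverage hconn hw hγ h
  · rintro (⟨⟨e⟩⟩ | ⟨⟨e⟩⟩ | ⟨⟨e⟩⟩ | ⟨⟨e⟩⟩ | ⟨⟨e⟩⟩ | ⟨⟨e⟩⟩)
    · exact connected_and_exhibitsPST_of_ringEquiv (closure_isUnit_zmod 2) (by decide)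
        aeval_unitAverage_zmod_two e
    · exact connected_and_exhibitsPST_of_ringEquiv (closure_isUnit_zmod 4) (by decide)
        aeval_unitAverage_zmod_four e
    · exact connected_and_exhibitsPST_of_ringEquiv closure_isUnit_ringG2 (by decide)
        aeval_unitAverage_ringG2 e
    · exact connected_and_exhibitsPST_of_ringEquiv (closure_isUnit_zmod 6) (by decide)
        aeval_unitAverage_zmod_six e
    · exact connected_and_exhibitsPST_of_ringEquiv (closure_isUnit_zmod 12) (by decide)
        aeval_unitAverage_zmod_twelve e
    · exact connected_and_exhibitsPST_of_ringEquiv closure_isUnit_zmod_three_prod_ringG2 (by decide)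
        aeval_unitAverage_zmod_three_prod_ringG2 e

end
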